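/- Let $\mathcal H_A=\mathcal H_B=(\mathbb C^2)^{\otimes 2}$ (two qubits each), let $P_0=|00\rangle\langle 00|+|11\rangle\langle 11|$ and $P_1=I_4-P_0$, and for $\beta\in[0,1]$ let $\mathcal N_\beta$ be the two-qubit block-depolarizing channel $$\mathcal N_\beta(\rho)=(1-\beta)\operatorname{Tr}(P_0\rho)\frac{P_0}{2}+(1-\beta)\operatorname{Tr}(P_1\rho)\frac{P_1}{2}+\beta\operatorname{Tr}(\rho)\frac{I_4}{4}.$$ Consider the product mechanism $\mathcal E=\mathcal N_{1/2}\otimes\mathcal N_{1/2}$ on $\mathcal H_A\otimes\mathcal H_B$. For $s\in\mathbb R$ let $\mathbb H_s$ be the set of density operators $\rho$ on $\mathcal H_A\otimes\mathcal H_B$ of rank one (pure states) whose entanglement entropy $\mathbf E(\rho)=-\operatorname{Tr}(\rho_A\log\rho_A)$, $\rho_A=\operatorname{Tr}_B\rho$, is at least $s$ ($\log$ is the natural logarithm). Say that $\mathcal E$ is ECLM-$\varepsilon$-QLDP on $\mathbb H_s$ if for all finite sets $O_A,O_B$, all local POVMs $\{M_a\}_{a\in O_A}$ on $\mathcal H_A$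 and $\{M_b\}_{b\in O_B}$ on $\mathcal H_B$, all $\rho,\rho'\in\mathbb H_s$ and all $T\subseteq O_A\times O_B$, $$\sum_{(a,b)\in T}\operatorname{Tr}\big((M_a\otimes M_b)\mathcal E(\rho)\big)\le e^{\varepsilon}\sum_{(a,b)\in T}\operatorname{Tr}\big((M_a\otimes M_b)\mathcal E(\rho')\big).$$ Let $\varepsilon^*(s)\in[-\infty,+\infty]$ be the optimal leakage level, i.e. the infimum of all $\varepsilon\in\mathbb R$ for which $\mathcal E$ is ECLM-$\varepsilon$-QLDP on $\mathbb H_s$. Then: 1. If $s\le\log 2$, then $\varepsilon^*(s)\le 2\log 3$. 2. If $\log 2<s\le\log 4$, then there is exactly one $\tau=\tau(s)\in[1/2,1]$ with $$s=\log 2-\tau\log\tau-(1-\tau)\log(1-\tau)$$ (with $0\log 0=0$), and $$\varepsilon^*(s)\le\log\frac{8\tau(s)+1}{3-2\tau(s)}.$$ Moreover, $s\mapsto\tau(s)$ is strictly decreasing on $(\log 2,\log 4]$. -/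

import Mathlib

open scoped Kronecker ComplexOrder

namespace QLDP

/-- The partial trace over the second factor of a bipartite operator, `ρ ↦ Tr_B ρ`. -/
def partialTraceB {m n : Type*} [Fintype n] (ρ : Matrix (m × n) (m × n) ℂ) : Matrix m m ℂ :=
  Matrix.of fun i j => ∑ k, ρ (i, k) (j, k)

open Classical in
/-- The von Neumann entropy `S(ρ) = -∑ λⱼ log λⱼ` (natural logarithm, `0 log 0 = 0`), where the
`λⱼ` are the eigenvalues of the Hermitian matrix `ρ`; only used for density matrices. -/
noncomputable def vonNeumannEntropy {m : Type*} [Fintype m] (ρ : Matrix m m ℂ) : ℝ :=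
  if h : ρ.IsHermitian then ∑ j, Real.negMulLog (h.eigenvalues j) else 0

/-- Density operators: positive semidefinite matrices of unit trace. -/
def IsDensity {m : Type*} [Fintype m] (ρ : Matrix m m ℂ) : Prop :=
  ρ.PosSemidef ∧ ρ.trace = 1

/-- The entanglement entropy of a bipartite pure state: the entropy of its reduced state on `A`. -/
noncomputable def entanglementEntropy {m n : Type*} [Fintype m] [Fintype n]
    (ρ : Matrix (m × n) (m × n) ℂ) : ℝ :=
  vonNeumannEntropy (partialTraceB ρ)

/-- The domain `ℍ_s`: the pure states of the bipartite system (density operators of rank one)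
whose entanglement entropy is at least `s`. -/
def entangledDomain (m n : Type*) [Fintype m] [Fintype n] (s : ℝ) :
    Set (Matrix (m × n) (m × n) ℂ) :=
  {ρ | IsDensity ρ ∧ ρ.rank = 1 ∧ s ≤ entanglementEntropy ρ}

/-- A positive operator-valued measurement with finite outcome set `O`. -/
structure POVM (O m : Type*) [Fintype O] [Fintype m] [DecidableEq m] where
  /-- The operator of each outcome. -/
  op : O → Matrix m m ℂ
  posSemidef : ∀ k, (op k).PosSemidef
  sum_eq_one : ∑ k, op k = 1

/-- `Pr[M(σ) ∈ T]` for the local measurement `M = {M_a ⊗ M_b}` performed on the state `σ`. -/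
noncomputable def localProb {OA OB m n : Type*} [Fintype OA] [Fintype OB] [Fintype m] [Fintype n]
    [DecidableEq m] [DecidableEq n] (MA : POVM OA m) (MB : POVM OB n)
    (σ : Matrix (m × n) (m × n) ℂ) (T : Finset (OA × OB)) : ℝ :=
  ∑ k ∈ T, (Matrix.trace ((MA.op k.1 ⊗ₖ MB.op k.2) * σ)).re

/-- The product mechanism `E_A ⊗ E_B` as a linear map on bipartite operators. -/
noncomputable def productMechanism {m n : Type*} [Fintype m] [Fintype n]
    [DecidableEq m] [DecidableEq n]
    (EA : Matrix m m ℂ →ₗ[ℂ] Matrix m m ℂ) (EB : Matrix n n ℂ →ₗ[ℂ] Matrix n n ℂ) :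
    Matrix (m × n) (m × n) ℂ →ₗ[ℂ] Matrix (m × n) (m × n) ℂ :=
  (kroneckerLinearEquiv m m n n ℂ).toLinearMap ∘ₗ TensorProduct.map EA EB ∘ₗ
    (kroneckerLinearEquiv m m n n ℂ).symm.toLinearMap

/-- `productMechanism EA EB` is the linear map with `X ⊗ Y ↦ E_A(X) ⊗ E_B(Y)`. -/
theorem productMechanism_kronecker {m n : Type*} [Fintype m] [Fintype n]
    [DecidableEq m] [DecidableEq n]
    (EA : Matrix m m ℂ →ₗ[ℂ] Matrix m m ℂ) (EB : Matrix n n ℂ →ₗ[ℂ] Matrix n n ℂ)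
    (X : Matrix m m ℂ) (Y : Matrix n n ℂ) :
    productMechanism EA EB (X ⊗ₖ Y) = EA X ⊗ₖ EB Y := by
  rw [← kroneckerLinearEquiv_tmul (R := ℂ) X Y]
  simp [productMechanism]

/-- `E` is entanglement-constrained `ε`-quantum locally differentially private against local
measurement adversaries on the domain `ℍ_s`. -/
def IsECLMQLDP {m n : Type*} [Fintype m] [Fintype n] [DecidableEq m] [DecidableEq n]
    (E : Matrix (m × n) (m × n) ℂ →ₗ[ℂ] Matrix (m × n) (m × n) ℂ) (s ε : ℝ) : Prop :=
  ∀ (OA OB : Type) [Fintype OA] [Fintype OB] (MA : POVM OA m) (MB : POVM OB n),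
    ∀ ρ ∈ entangledDomain m n s, ∀ ρ' ∈ entangledDomain m n s, ∀ T : Finset (OA × OB),
      localProb MA MB (E ρ) T ≤ Real.exp ε * localProb MA MB (E ρ') T

/-- The optimal leakage level `ε*(s)`: the infimum of all `ε` for which `E` is private, in the
extended reals, so that it is `+∞` if `E` is private for no `ε`. -/
noncomputable def optimalLeakage {m n : Type*} [Fintype m] [Fintype n] [DecidableEq m]
    [DecidableEq n] (E : Matrix (m × n) (m × n) ℂ →ₗ[ℂ] Matrix (m × n) (m × n) ℂ) (s : ℝ) :
    EReal :=
  sInf ((fun ε : ℝ => (ε : EReal)) '' {ε : ℝ | IsECLMQLDP E s ε})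

/-- The index set of the computational basis `|00⟩, |01⟩, |10⟩, |11⟩` of two qubits. -/
abbrev TwoQubit : Type := Fin 2 × Fin 2

/-- The even projector `P₀ = |00⟩⟨00| + |11⟩⟨11|`. -/
noncomputable def evenProj : Matrix TwoQubit TwoQubit ℂ :=
  Matrix.single (0, 0) (0, 0) 1 + Matrix.single (1, 1) (1, 1) 1

/-- The odd projector `P₁ = I₄ - P₀`. -/
noncomputable def oddProj : Matrix TwoQubit TwoQubit ℂ := 1 - evenProj

/-- The two-qubit block-depolarizing channel
`N_β(ρ) = (1-β) Tr(P₀ρ) P₀/2 + (1-β) Tr(P₁ρ) P₁/2 + β Tr(ρ) I₄/4`; the factor `Tr(ρ)`, which is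
`1` on density operators, makes it linear on all operators. -/
noncomputable def blockDepolarizing (β : ℝ) :
    Matrix TwoQubit TwoQubit ℂ →ₗ[ℂ] Matrix TwoQubit TwoQubit ℂ where
  toFun ρ :=
    ((1 - β : ℂ) * (evenProj * ρ).trace / 2) • evenProj
      + ((1 - β : ℂ) * (oddProj * ρ).trace / 2) • oddProj
      + ((β : ℂ) * ρ.trace / 4) • (1 : Matrix TwoQubit TwoQubit ℂ)
  map_add' X Y := by
    simp only [Matrix.mul_add, Matrix.trace_add]
    module
  map_smul' c X := by
    simp only [Matrix.mul_smul, Matrix.trace_smul, smul_eq_mul, RingHom.id_apply]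
    module

end QLDP

namespace QLDP

open Matrix Real

/-! ### Entropy bounds -/

section Entropy

variable {m : Type*} [Fintype m]

/-! The mechanism sees a state only through the joint distribution `p k l` of the parities on the
two sides. By `trace_re_eq_sum_outputWeight`, every local outcome probability is a combination of
the numbers `outputWeight ρ k l` whose nonnegative coefficients depend only on the measurement.
Uniform bounds `b ≤ outputWeight ≤ a` therefore give leakage at most `log (a / b)`.

Entropy controls these numbers through the marginals of `p`. A two-qubit state with parity weight
`w` has entropy at most `log 2 + binEntropy w`, and `binEntropy` strictly decreases on `[1/2, 1]`,
so entropy at least `log 2 + binEntropy t` forces both parity weights to be at most `t`. For a pure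
state this applies to both reductions, which have equal entropy. `outputWeight_bounds` turns this
into `3 - 2t` and `8t + 1`; the trivial `t = 1` gives `9 / 1`. -/

theorem vonNeumannEntropy_eq_sum_eigenvalues {A : Matrix m m ℂ} [DecidableEq m]
    (hA : A.IsHermitian) : vonNeumannEntropy A = ∑ j, negMulLog (hA.eigenvalues j) := by
  rw [vonNeumannEntropy, dif_pos hA]
  congr!

/-- Reduces equality of entropies to equality of characteristic polynomials. -/
theorem vonNeumannEntropy_eq_sum_roots {A : Matrix m m ℂ} [DecidableEq m] (hA : A.IsHermitian) :
    vonNeumannEntropy A = (A.charpoly.roots.map fun z => negMulLog z.re).sum := by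
  rw [vonNeumannEntropy_eq_sum_eigenvalues hA, hA.roots_charpoly_eq_eigenvalues, Multiset.map_map]
  rfl

/-- The entropy of a state is at most the Shannon entropy of its diagonal. -/
theorem vonNeumannEntropy_le_sum_diag {A : Matrix m m ℂ} (hA : A.PosSemidef) :
    vonNeumannEntropy A ≤ ∑ i, negMulLog (A i i).re := by
  classical
  have hH := hA.isHermitian
  rw [vonNeumannEntropy_eq_sum_eigenvalues hH]
  set U : Matrix m m ℂ := (hH.eigenvectorUnitary : Matrix m m ℂ)
  have hU1 : U * star U = 1 := Unitary.coe_mul_star_self hH.eigenvectorUnitary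
  have hU2 : star U * U = 1 := Unitary.coe_star_mul_self hH.eigenvectorUnitary
  -- The matrix `|U i j|²` is doubly stochastic and maps the spectrum to the diagonal: row sums
  -- allow Jensen for each diagonal entry, column sums recover the entropy.
  have hrow : ∀ i, ∑ j, Complex.normSq (U i j) = 1 := by
    intro i
    have h := congrFun₂ hU1 i i
    simp only [mul_apply, star_apply, RCLike.star_def, Complex.mul_conj, one_apply_eq] at h
    exact_mod_cast h
  have hcol : ∀ j, ∑ i, Complex.normSq (U i j) = 1 := by
    intro j
    have h := congrFun₂ hU2 j j
    simp only [mul_apply, star_apply, RCLike.star_def, mul_comm, Complex.mul_conj,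
      one_apply_eq] at h
    exact_mod_cast h
  have hdiag : ∀ i, (A i i).re = ∑ j, Complex.normSq (U i j) * hH.eigenvalues j := by
    intro i
    have h := congrFun₂ hH.spectral_theorem i i
    rw [Unitary.conjStarAlgAut_apply, mul_apply] at h
    rw [h, Complex.re_sum]
    refine Finset.sum_congr rfl fun j _ => ?_
    rw [mul_diagonal, star_apply, RCLike.star_def]
    change (U i j * (hH.eigenvalues j : ℂ) * (starRingEnd ℂ) (U i j)).re = _
    rw [mul_right_comm, Complex.mul_conj, ← Complex.ofReal_mul, Complex.ofReal_re]
  calc ∑ j, negMulLog (hH.eigenvalues j)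
      = ∑ j, ∑ i, Complex.normSq (U i j) * negMulLog (hH.eigenvalues j) := by
        simp_rw [← Finset.sum_mul, hcol, one_mul]
    _ = ∑ i, ∑ j, Complex.normSq (U i j) * negMulLog (hH.eigenvalues j) := Finset.sum_comm
    _ ≤ ∑ i, negMulLog (A i i).re := by
        refine Finset.sum_le_sum fun i _ => ?_
        rw [hdiag]
        exact concaveOn_negMulLog.le_map_sum (fun j _ => Complex.normSq_nonneg _) (hrow i)
          (fun j _ => hA.eigenvalues_nonneg j)

/-- Concavity at the midpoint: splitting a mass into two parts gains the most when the parts are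
equal. -/
theorem negMulLog_add_negMulLog_le {x y : ℝ} (hx : 0 ≤ x) (hy : 0 ≤ y) :
    negMulLog x + negMulLog y ≤ negMulLog (x + y) + (x + y) * log 2 := by
  have h := concaveOn_negMulLog.2 (Set.mem_Ici.2 hx) (Set.mem_Ici.2 hy)
    (show (0 : ℝ) ≤ 2⁻¹ by norm_num) (show (0 : ℝ) ≤ 2⁻¹ by norm_num) (by norm_num)
  have h2 : negMulLog (2⁻¹ * (x + y)) = 2⁻¹ * negMulLog (x + y) + (x + y) * (2⁻¹ * log 2) := by
    rw [negMulLog_mul]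
    simp only [negMulLog, log_inv]
    ring
  simp only [smul_eq_mul, ← mul_add, h2] at h
  linarith

end Entropy

/-! ### Parity blocks -/

/-- The projector onto the two basis vectors of parity `k`. -/
def parityProj (k : Fin 2) : Matrix TwoQubit TwoQubit ℂ :=
  diagonal fun x => if x.1 + x.2 = k then 1 else 0

theorem evenProj_eq : evenProj = parityProj 0 := by
  ext ⟨a, b⟩ ⟨c, d⟩
  fin_cases a <;> fin_cases b <;> fin_cases c <;> fin_cases d <;>
    simp [evenProj, parityProj]

theorem oddProj_eq : oddProj = parityProj 1 := by
  rw [oddProj, evenProj_eq]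
  ext ⟨a, b⟩ ⟨c, d⟩
  fin_cases a <;> fin_cases b <;> fin_cases c <;> fin_cases d <;>
    simp [parityProj, one_apply]

/-- The probability of parity `k` in the state `X`. -/
noncomputable def parityWeight (X : Matrix TwoQubit TwoQubit ℂ) (k : Fin 2) : ℝ :=
  (parityProj k * X).trace.re

theorem trace_parityProj_mul (X : Matrix TwoQubit TwoQubit ℂ) (k : Fin 2) :
    (parityProj k * X).trace = X (0, k) (0, k) + X (1, 1 - k) (1, 1 - k) := by
  simp only [parityProj, trace, diag, diagonal_mul, Fintype.sum_prod_type, Fin.sum_univ_two]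
  fin_cases k <;> simp

theorem coe_parityWeight {X : Matrix TwoQubit TwoQubit ℂ} (hX : X.PosSemidef) (k : Fin 2) :
    (parityWeight X k : ℂ) = (parityProj k * X).trace := by
  rw [parityWeight, trace_parityProj_mul, Complex.add_re, Complex.ofReal_add]
  congr 1 <;> exact (Complex.conj_eq_iff_re.1 (hX.isHermitian.apply _ _))

theorem parityWeight_nonneg {X : Matrix TwoQubit TwoQubit ℂ} (hX : X.PosSemidef) (k : Fin 2) :
    0 ≤ parityWeight X k := by
  rw [parityWeight, trace_parityProj_mul, Complex.add_re]
  exact add_nonneg (Complex.le_def.1 (hX.diag_nonneg (i := (0, k)))).1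
    (Complex.le_def.1 (hX.diag_nonneg (i := (1, 1 - k)))).1

theorem parityWeight_add {X : Matrix TwoQubit TwoQubit ℂ} (h : X.trace = 1) (k : Fin 2) :
    parityWeight X k + parityWeight X (1 - k) = 1 := by
  have h' := congrArg Complex.re h
  simp only [trace, diag, Fintype.sum_prod_type, Fin.sum_univ_two, Complex.add_re,
    Complex.one_re] at h'
  simp only [parityWeight, trace_parityProj_mul, Complex.add_re]
  fin_cases k <;> simp <;> linarith

/-- Group the four diagonal entries by parity: each block of two contributes at most its weight
times `log 2` beyond the entropy of the grouped distribution. -/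
theorem vonNeumannEntropy_le_binEntropy {A : Matrix TwoQubit TwoQubit ℂ} (hA : IsDensity A)
    (k : Fin 2) : vonNeumannEntropy A ≤ log 2 + binEntropy (parityWeight A k) := by
  have hd : ∀ i, 0 ≤ (A i i).re := fun i => (Complex.le_def.1 hA.1.diag_nonneg).1
  have h := vonNeumannEntropy_le_sum_diag hA.1
  have hk : ∀ l, parityWeight A l = (A (0, l) (0, l)).re + (A (1, 1 - l) (1, 1 - l)).re := by
    intro l
    rw [parityWeight, trace_parityProj_mul, Complex.add_re]
  have hadd := parityWeight_add hA.2 k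
  have h1 := negMulLog_add_negMulLog_le (hd (0, k)) (hd (1, 1 - k))
  have h2 := negMulLog_add_negMulLog_le (hd (0, 1 - k)) (hd (1, 1 - (1 - k)))
  rw [← hk] at h1 h2
  rw [binEntropy_eq_negMulLog_add_negMulLog_one_sub, ← eq_sub_of_add_eq' hadd]
  have h3 : ∑ i, negMulLog (A i i).re =
      negMulLog (A (0, k) (0, k)).re + negMulLog (A (1, 1 - k) (1, 1 - k)).re +
        (negMulLog (A (0, 1 - k) (0, 1 - k)).re +
          negMulLog (A (1, 1 - (1 - k)) (1, 1 - (1 - k))).re) := by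
    simp only [Fintype.sum_prod_type, Fin.sum_univ_two]
    fin_cases k <;> simp <;> ring
  have h4 : parityWeight A k * log 2 + parityWeight A (1 - k) * log 2 = log 2 := by
    rw [← add_mul, hadd, one_mul]
  linarith

theorem parityWeight_le_of_binEntropy_le {A : Matrix TwoQubit TwoQubit ℂ} (hA : IsDensity A)
    {t : ℝ} (ht : t ∈ Set.Icc (2⁻¹ : ℝ) 1)
    (h : log 2 + binEntropy t ≤ vonNeumannEntropy A) (k : Fin 2) : parityWeight A k ≤ t := by
  by_contra! hlt
  have h1 : parityWeight A k ≤ 1 := by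
    linarith [parityWeight_add hA.2 k, parityWeight_nonneg hA.1 (1 - k)]
  have := binEntropy_strictAntiOn ht ⟨ht.1.trans hlt.le, h1⟩ hlt
  linarith [vonNeumannEntropy_le_binEntropy hA k]

/-! ### Reduced states of a pure state -/

section Pure

variable {m n : Type*} [Fintype m] [Fintype n]

/-- The partial trace over the first factor of a bipartite operator. -/
def partialTraceA (ρ : Matrix (m × n) (m × n) ℂ) : Matrix n n ℂ :=
  Matrix.of fun k l => ∑ i, ρ (i, k) (i, l)

theorem exists_eq_mul_conj_of_rank_eq_one {A : Matrix m m ℂ} (hA : A.PosSemidef)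
    (hr : A.rank = 1) : ∃ v : m → ℂ, ∀ i j, A i j = v i * star (v j) := by
  classical
  have hH := hA.isHermitian
  rw [hH.rank_eq_card_non_zero_eigs, Fintype.card_eq_one_iff] at hr
  obtain ⟨⟨k, hk⟩, hk'⟩ := hr
  -- The eigenvector of the only nonzero eigenvalue, scaled by its square root.
  refine ⟨fun i => (√(hH.eigenvalues k) : ℂ) * (hH.eigenvectorUnitary : Matrix m m ℂ) i k,
    fun i j => ?_⟩
  have h := congrFun₂ hH.spectral_theorem i j
  rw [Unitary.conjStarAlgAut_apply, mul_apply] at h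
  rw [h, Finset.sum_eq_single k]
  · have hs : (hH.eigenvalues k : ℂ) = √(hH.eigenvalues k) * √(hH.eigenvalues k) := by
      rw [← Complex.ofReal_mul, Real.mul_self_sqrt (hA.eigenvalues_nonneg k)]
    rw [mul_diagonal, star_apply]
    change _ * (hH.eigenvalues k : ℂ) * _ = _
    simp only [hs, star_mul', RCLike.star_def, Complex.conj_ofReal]
    ring
  · intro b _ hb
    have : hH.eigenvalues b = 0 := by
      by_contra hne
      exact hb (congrArg Subtype.val (hk' ⟨b, hne⟩))
    rw [mul_diagonal]
    simp [this]
  · simp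

theorem partialTraceB_isDensity {ρ : Matrix (m × n) (m × n) ℂ} (hρ : IsDensity ρ)
    (hr : ρ.rank = 1) : IsDensity (partialTraceB ρ) := by
  obtain ⟨v, hv⟩ := exists_eq_mul_conj_of_rank_eq_one hρ.1 hr
  refine ⟨?_, ?_⟩
  · have : partialTraceB ρ = (of fun i k => v (i, k)) * (of fun i k => v (i, k))ᴴ := by
      ext i j
      simp [partialTraceB, hv, mul_apply]
    rw [this]
    exact posSemidef_self_mul_conjTranspose _
  · rw [← hρ.2]
    simp [trace, partialTraceB, Fintype.sum_prod_type]

theorem partialTraceA_isDensity {ρ : Matrix (m × n) (m × n) ℂ} (hρ : IsDensity ρ)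
    (hr : ρ.rank = 1) : IsDensity (partialTraceA ρ) := by
  obtain ⟨v, hv⟩ := exists_eq_mul_conj_of_rank_eq_one hρ.1 hr
  refine ⟨?_, ?_⟩
  · have : partialTraceA ρ = (of fun k i => v (i, k)) * (of fun k i => v (i, k))ᴴ := by
      ext i j
      simp [partialTraceA, hv, mul_apply]
    rw [this]
    exact posSemidef_self_mul_conjTranspose _
  · rw [← hρ.2]
    simp only [trace, partialTraceA, Fintype.sum_prod_type, diag, of_apply]
    exact Finset.sum_comm

/-- The two reduced states of a pure state have the same entropy. -/
theorem vonNeumannEntropy_partialTraceA {ρ : Matrix (m × m) (m × m) ℂ} (hρ : IsDensity ρ)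
    (hr : ρ.rank = 1) :
    vonNeumannEntropy (partialTraceA ρ) = vonNeumannEntropy (partialTraceB ρ) := by
  classical
  obtain ⟨v, hv⟩ := exists_eq_mul_conj_of_rank_eq_one hρ.1 hr
  set C : Matrix m m ℂ := of fun i k => v (i, k) with hC
  have h1 : partialTraceB ρ = C * Cᴴ := by
    ext i j
    simp [partialTraceB, hv, mul_apply, hC]
  have h2 : partialTraceA ρ = (Cᴴ * C)ᵀ := by
    ext i j
    simp [partialTraceA, hv, mul_apply, hC, mul_comm]
  -- For the square coefficient matrix `C`, `C * Cᴴ` and `Cᴴ * C` have the same characteristic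
  -- polynomial, and transposing does not change it.
  rw [vonNeumannEntropy_eq_sum_roots (partialTraceA_isDensity hρ hr).1.isHermitian,
    vonNeumannEntropy_eq_sum_roots (partialTraceB_isDensity hρ hr).1.isHermitian, h1, h2,
    charpoly_transpose, charpoly_mul_comm]

end Pure

/-! ### Output probabilities of the mechanism -/

/-- The probability of the parities `k` and `l` in the bipartite state `ρ`. -/
noncomputable def jointWeight (ρ : Matrix (TwoQubit × TwoQubit) (TwoQubit × TwoQubit) ℂ)
    (k l : Fin 2) : ℝ :=
  ((parityProj k ⊗ₖ parityProj l) * ρ).trace.re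

theorem trace_kronecker_parityProj_mul
    (ρ : Matrix (TwoQubit × TwoQubit) (TwoQubit × TwoQubit) ℂ) (k l : Fin 2) :
    ((parityProj k ⊗ₖ parityProj l) * ρ).trace =
      ρ ((0, k), (0, l)) ((0, k), (0, l))
        + ρ ((0, k), (1, 1 - l)) ((0, k), (1, 1 - l))
        + (ρ ((1, 1 - k), (0, l)) ((1, 1 - k), (0, l))
          + ρ ((1, 1 - k), (1, 1 - l)) ((1, 1 - k), (1, 1 - l))) := by
  simp only [parityProj, diagonal_kronecker_diagonal, trace, diag, diagonal_mul,
    Fintype.sum_prod_type, Fin.sum_univ_two]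
  fin_cases k <;> fin_cases l <;> simp

theorem jointWeight_nonneg {ρ : Matrix (TwoQubit × TwoQubit) (TwoQubit × TwoQubit) ℂ}
    (hρ : ρ.PosSemidef) (k l : Fin 2) : 0 ≤ jointWeight ρ k l := by
  have h : ∀ i, 0 ≤ (ρ i i).re := fun i => (Complex.le_def.1 hρ.diag_nonneg).1
  simp only [jointWeight, trace_kronecker_parityProj_mul, Complex.add_re]
  exact add_nonneg (add_nonneg (h _) (h _)) (add_nonneg (h _) (h _))

theorem coe_jointWeight {ρ : Matrix (TwoQubit × TwoQubit) (TwoQubit × TwoQubit) ℂ}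
    (hρ : ρ.PosSemidef) (k l : Fin 2) :
    (jointWeight ρ k l : ℂ) = ((parityProj k ⊗ₖ parityProj l) * ρ).trace := by
  have h : ∀ i, ((ρ i i).re : ℂ) = ρ i i := fun i =>
    Complex.conj_eq_iff_re.1 (hρ.isHermitian.apply _ _)
  simp only [jointWeight, trace_kronecker_parityProj_mul, Complex.add_re, Complex.ofReal_add, h]

theorem jointWeight_add_right (ρ : Matrix (TwoQubit × TwoQubit) (TwoQubit × TwoQubit) ℂ)
    (k l : Fin 2) :
    jointWeight ρ k l + jointWeight ρ k (1 - l) = parityWeight (partialTraceB ρ) k := by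
  simp only [jointWeight, trace_kronecker_parityProj_mul, parityWeight, trace_parityProj_mul,
    partialTraceB, of_apply, Fintype.sum_prod_type, Fin.sum_univ_two, Complex.add_re]
  fin_cases l <;> simp <;> ring

theorem jointWeight_add_left (ρ : Matrix (TwoQubit × TwoQubit) (TwoQubit × TwoQubit) ℂ)
    (k l : Fin 2) :
    jointWeight ρ k l + jointWeight ρ (1 - k) l = parityWeight (partialTraceA ρ) l := by
  simp only [jointWeight, trace_kronecker_parityProj_mul, parityWeight, trace_parityProj_mul,
    partialTraceA, of_apply, Fintype.sum_prod_type, Fin.sum_univ_two, Complex.add_re]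
  fin_cases k <;> simp <;> ring

theorem blockDepolarizing_half_apply (X : Matrix TwoQubit TwoQubit ℂ) :
    blockDepolarizing (1 / 2) X =
      ∑ k, (parityProj k * X).trace • ((1 / 4 : ℂ) • parityProj k + (1 / 8 : ℂ) • 1) := by
  have h1 : (1 : Matrix TwoQubit TwoQubit ℂ) = parityProj 0 + parityProj 1 := by
    rw [← evenProj_eq, ← oddProj_eq, oddProj]
    abel
  have hX : X.trace = (parityProj 0 * X).trace + (parityProj 1 * X).trace := by
    rw [← trace_add, ← add_mul, ← h1, one_mul]
  change ((1 - ((1 / 2 : ℝ) : ℂ)) * (evenProj * X).trace / 2) • evenProj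
      + ((1 - ((1 / 2 : ℝ) : ℂ)) * (oddProj * X).trace / 2) • oddProj
      + (((1 / 2 : ℝ) : ℂ) * X.trace / 4) • (1 : Matrix TwoQubit TwoQubit ℂ) = _
  rw [evenProj_eq, oddProj_eq, hX, Fin.sum_univ_two]
  push_cast
  module

/-- At `β = 1/2` each basis vector of the input's parity gets `1/4 + 1/8 = 3/8`, and each of the
other parity `1/8`. -/
theorem trace_mul_blockDepolarizing_half (M X : Matrix TwoQubit TwoQubit ℂ) :
    (M * blockDepolarizing (1 / 2) X).trace =
      ∑ k, ((3 * (parityProj k * M).trace + (parityProj (1 - k) * M).trace) / 8) *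
        (parityProj k * X).trace := by
  have h1 : (1 : Matrix TwoQubit TwoQubit ℂ) = parityProj 0 + parityProj 1 := by
    rw [← evenProj_eq, ← oddProj_eq, oddProj]
    abel
  rw [blockDepolarizing_half_apply, Fin.sum_univ_two, Fin.sum_univ_two, h1]
  simp only [mul_add, mul_smul_comm, trace_add, trace_smul, smul_eq_mul,
    trace_mul_comm M]
  simp
  ring

theorem trace_kronecker_mul_productMechanism (M N : Matrix TwoQubit TwoQubit ℂ)
    (ρ : Matrix (TwoQubit × TwoQubit) (TwoQubit × TwoQubit) ℂ) :
    ((M ⊗ₖ N) * productMechanism (blockDepolarizing (1 / 2)) (blockDepolarizing (1 / 2)) ρ).trace =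
      ∑ k, ∑ l, ((3 * (parityProj k * M).trace + (parityProj (1 - k) * M).trace) / 8) *
        ((3 * (parityProj l * N).trace + (parityProj (1 - l) * N).trace) / 8) *
        ((parityProj k ⊗ₖ parityProj l) * ρ).trace := by
  -- Both sides are linear in `ρ`, so product operators suffice.
  obtain ⟨z, rfl⟩ := (kroneckerLinearEquiv TwoQubit TwoQubit TwoQubit TwoQubit ℂ).surjective ρ
  induction z using TensorProduct.induction_on with
  | zero => simp
  | tmul X Y =>
    rw [kroneckerLinearEquiv_tmul, productMechanism_kronecker, ← mul_kronecker_mul,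
      trace_kronecker, trace_mul_blockDepolarizing_half, trace_mul_blockDepolarizing_half,
      Finset.sum_mul_sum]
    simp only [← mul_kronecker_mul, trace_kronecker]
    refine Finset.sum_congr rfl fun k _ => Finset.sum_congr rfl fun l _ => ?_
    ring
  | add x y hx hy =>
    simp only [map_add, mul_add, trace_add, hx, hy, Finset.sum_add_distrib]

/-- Up to the factor `64`, the probability that the output state of the mechanism on `ρ` has
parities `k` and `l`. -/
noncomputable def outputWeight (ρ : Matrix (TwoQubit × TwoQubit) (TwoQubit × TwoQubit) ℂ)
    (k l : Fin 2) : ℝ :=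
  9 * jointWeight ρ k l + 3 * (jointWeight ρ k (1 - l) + jointWeight ρ (1 - k) l) +
    jointWeight ρ (1 - k) (1 - l)

theorem trace_re_eq_sum_outputWeight {M N : Matrix TwoQubit TwoQubit ℂ} (hM : M.PosSemidef)
    (hN : N.PosSemidef) {ρ : Matrix (TwoQubit × TwoQubit) (TwoQubit × TwoQubit) ℂ}
    (hρ : ρ.PosSemidef) :
    ((M ⊗ₖ N) *
        productMechanism (blockDepolarizing (1 / 2)) (blockDepolarizing (1 / 2)) ρ).trace.re =
      ∑ k, ∑ l, parityWeight M k * parityWeight N l * outputWeight ρ k l / 64 := by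
  rw [trace_kronecker_mul_productMechanism]
  simp only [← coe_parityWeight hM, ← coe_parityWeight hN, ← coe_jointWeight hρ]
  rw [← Complex.ofReal_re
    (∑ k, ∑ l, parityWeight M k * parityWeight N l * outputWeight ρ k l / 64)]
  congr 1
  simp only [outputWeight, Fin.sum_univ_two]
  push_cast
  ring

theorem isECLMQLDP_of_outputWeight_le {s K : ℝ} (hK : 0 < K)
    (h : ∀ ρ ∈ entangledDomain TwoQubit TwoQubit s, ∀ ρ' ∈ entangledDomain TwoQubit TwoQubit s,
      ∀ k l, outputWeight ρ k l ≤ K * outputWeight ρ' k l) :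
    IsECLMQLDP (productMechanism (blockDepolarizing (1 / 2)) (blockDepolarizing (1 / 2)))
      s (log K) := by
  intro OA OB _ _ MA MB ρ hρ ρ' hρ' T
  rw [exp_log hK, localProb, localProb, Finset.mul_sum]
  refine Finset.sum_le_sum fun c _ => ?_
  have hM := MA.posSemidef c.1
  have hN := MB.posSemidef c.2
  rw [trace_re_eq_sum_outputWeight hM hN hρ.1.1, trace_re_eq_sum_outputWeight hM hN hρ'.1.1]
  simp only [Finset.mul_sum]
  refine Finset.sum_le_sum fun k _ => Finset.sum_le_sum fun l _ => ?_
  have := mul_le_mul_of_nonneg_left (h ρ hρ ρ' hρ' k l)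
    (mul_nonneg (parityWeight_nonneg hM k) (parityWeight_nonneg hN l))
  linarith

theorem optimalLeakage_le_of_outputWeight_le {s a b : ℝ} (ha : 0 < a) (hb : 0 < b)
    (h : ∀ ρ ∈ entangledDomain TwoQubit TwoQubit s, ∀ k l,
      b ≤ outputWeight ρ k l ∧ outputWeight ρ k l ≤ a) :
    optimalLeakage (productMechanism (blockDepolarizing (1 / 2)) (blockDepolarizing (1 / 2))) s
      ≤ ((log (a / b) : ℝ) : EReal) := by
  refine sInf_le ⟨_, isECLMQLDP_of_outputWeight_le (div_pos ha hb) ?_, rfl⟩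
  intro ρ hρ ρ' hρ' k l
  calc outputWeight ρ k l ≤ a := (h ρ hρ k l).2
    _ = a / b * b := by field_simp
    _ ≤ a / b * outputWeight ρ' k l :=
      mul_le_mul_of_nonneg_left (h ρ' hρ' k l).1 (div_pos ha hb).le

/-- Marginal bounds `t` on the parities of the reduced states bound the output of the mechanism. -/
theorem outputWeight_bounds {ρ : Matrix (TwoQubit × TwoQubit) (TwoQubit × TwoQubit) ℂ}
    (hρ : IsDensity ρ) (hr : ρ.rank = 1) {t : ℝ}
    (hB : ∀ k, parityWeight (partialTraceB ρ) k ≤ t)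
    (hA : ∀ k, parityWeight (partialTraceA ρ) k ≤ t) (k l : Fin 2) :
    3 - 2 * t ≤ outputWeight ρ k l ∧ outputWeight ρ k l ≤ 8 * t + 1 := by
  have p1 := jointWeight_nonneg hρ.1 k l
  have p2 := jointWeight_nonneg hρ.1 k (1 - l)
  have p3 := jointWeight_nonneg hρ.1 (1 - k) l
  have e1 := jointWeight_add_right ρ k l
  have e2 := jointWeight_add_right ρ (1 - k) l
  have e3 := jointWeight_add_left ρ k l
  have e4 := parityWeight_add (partialTraceB_isDensity hρ hr).2 k
  have b1 := hB k
  have b2 := hB (1 - k)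
  have b3 := hA l
  -- With `p` the joint weights and `q k`, `r l` the marginals, the output weight is `1 + 2 * q k +
  -- 2 * r l + 4 * p k l`. The upper bound uses `p k l ≤ q k ≤ t` and `r l ≤ t`; the lower one needs
  -- only `q k ≥ 1 - t`.
  simp only [outputWeight]
  constructor <;> linarith

/-! ### The threshold -/

theorem exists_binEntropy_eq {s : ℝ} (hs : s ∈ Set.Ioc (log 2) (log 4)) :
    ∃ t ∈ Set.Icc (2⁻¹ : ℝ) 1, log 2 + binEntropy t = s := by
  have h4 : log 4 = 2 * log 2 := by
    rw [show (4 : ℝ) = 2 ^ 2 by norm_num, log_pow]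
    norm_num
  have h := intermediate_value_Icc' (show (2⁻¹ : ℝ) ≤ 1 by norm_num)
    binEntropy_continuous.continuousOn
  rw [binEntropy_one, binEntropy_two_inv] at h
  obtain ⟨t, ht, hts⟩ := h (show s - log 2 ∈ Set.Icc 0 (log 2) from
    ⟨by linarith [hs.1], by linarith [hs.2]⟩)
  exact ⟨t, ht, by linarith⟩

theorem log_two_add_binEntropy (t : ℝ) :
    log 2 + binEntropy t = log 2 - t * log t - (1 - t) * log (1 - t) := by
  rw [binEntropy_eq_negMulLog_add_negMulLog_one_sub, negMulLog, negMulLog]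
  ring

end QLDP

open QLDP in
theorem mainTheorem6 :
    (∀ s : ℝ, s ≤ Real.log 2 →
      QLDP.optimalLeakage
          (QLDP.productMechanism (QLDP.blockDepolarizing (1 / 2)) (QLDP.blockDepolarizing (1 / 2))) s
        ≤ ((2 * Real.log 3 : ℝ) : EReal)) ∧
    ∃ τ : ℝ → ℝ,
      StrictAntiOn τ (Set.Ioc (Real.log 2) (Real.log 4)) ∧
      ∀ s ∈ Set.Ioc (Real.log 2) (Real.log 4),
        (∀ t : ℝ,
          (t ∈ Set.Icc (1 / 2 : ℝ) 1 ∧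
            s = Real.log 2 - t * Real.log t - (1 - t) * Real.log (1 - t)) ↔ t = τ s) ∧
        QLDP.optimalLeakage
            (QLDP.productMechanism (QLDP.blockDepolarizing (1 / 2))
              (QLDP.blockDepolarizing (1 / 2))) s
          ≤ ((Real.log ((8 * τ s + 1) / (3 - 2 * τ s)) : ℝ) : EReal) := by
  refine ⟨fun s _ => ?_, ?_⟩
  · have h9 : 2 * Real.log 3 = Real.log (9 / 1) := by
      rw [show (9 / 1 : ℝ) = 3 ^ 2 by norm_num, Real.log_pow]
      norm_num
    rw [h9]
    refine optimalLeakage_le_of_outputWeight_le (by norm_num) one_pos fun ρ hρ k l => ?_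
    have hle : ∀ {A : Matrix TwoQubit TwoQubit ℂ}, IsDensity A → ∀ k, parityWeight A k ≤ 1 :=
      fun hA k => by linarith [parityWeight_add hA.2 k, parityWeight_nonneg hA.1 (1 - k)]
    have h := outputWeight_bounds hρ.1 hρ.2.1 (hle (partialTraceB_isDensity hρ.1 hρ.2.1))
      (hle (partialTraceA_isDensity hρ.1 hρ.2.1)) k l
    constructor <;> linarith [h.1, h.2]
  · choose! τ hτ hτs using fun s (hs : s ∈ Set.Ioc (Real.log 2) (Real.log 4)) =>
      exists_binEntropy_eq hs
    refine ⟨τ, fun s hs s' hs' hlt => ?_, fun s hs => ⟨fun t => ?_, ?_⟩⟩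
    -- `τ` inverts the strictly decreasing `t ↦ log 2 + binEntropy t`.
    · refine (Real.binEntropy_strictAntiOn.lt_iff_gt (hτ s hs) (hτ s' hs')).1 ?_
      linarith [hτs s hs, hτs s' hs']
    · rw [← log_two_add_binEntropy, one_div]
      constructor
      · rintro ⟨ht, hts⟩
        refine Real.binEntropy_strictAntiOn.injOn ht (hτ s hs) ?_
        linarith [hτs s hs]
      · rintro rfl
        exact ⟨hτ s hs, (hτs s hs).symm⟩
    · have h1 := (hτ s hs).1
      have h2 := (hτ s hs).2
      refine optimalLeakage_le_of_outputWeight_le (by linarith) (by linarith)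
        fun ρ hρ => outputWeight_bounds hρ.1 hρ.2.1 ?_ ?_
      · refine parityWeight_le_of_binEntropy_le (partialTraceB_isDensity hρ.1 hρ.2.1)
          (hτ s hs) ?_
        rw [hτs s hs]
        exact hρ.2.2
      · refine parityWeight_le_of_binEntropy_le (partialTraceA_isDensity hρ.1 hρ.2.1)
          (hτ s hs) ?_
        rw [hτs s hs, vonNeumannEntropy_partialTraceA hρ.1 hρ.2.1]
        exact hρ.2.2
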